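/- Let $\mathcal H$ be a complex Hilbert space, let $0\le q<1$, and let $S$ be a closable linear operator in $\mathcal H$ (possibly unbounded, with domain $\mathcal D(S)$, closure $\bar S$ and Hilbert space adjoint $S^*$). Suppose that there is given a linear subspace $\mathcal D$, dense in $\mathcal H$, such that $\mathcal D\subset\mathcal D(S^*\bar S)\cap\mathcal D(\bar S S^*)$ and $$S^*\bar S f-q\,\bar S S^* f=f,\qquad f\in\mathcal D$$ (so that, in particular, $S$ is densely defined). Here products of operators are taken on their maximal domains. A densely defined operator $A$ in a Hilbert space is called *hyponormal* if $\mathcal D(A)\subset\mathcal D(A^*)$ and $\|A^*f\|\le\|Af\|$ for all $f\in\mathcal D(A)$. A hyponormal operator $N$ is called *normal* if $\|Nf\|=\|N^*f\|$ for all $f\in\mathcal D(N)$ and $\mathcal D(N)=\mathcal D(N^*)$. A densely defined operator $A$ in $\mathcal H$ is called *subnormal* if there are a Hilbert space $\mathcal K$ containing $\mathcal H$ isometrically and a normal operator $N$ in $\mathcal K$ such that $A\subset N$. The operator $S$ is called *bounded* if there is a constant $M$ with $\|Sf\|\le M\|f\|$ for all $f\in\mathcal D(S)$, and then $\|S\|$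 denotes the least such $M\ge 0$. Then the following conditions are equivalent: (i) $S$ is bounded and $\|S\|\le(1-q)^{-1/2}$; (ii) $S$ is bounded; (iii) $S$ is subnormal; (iv) $S$ is hyponormal. -/

import Mathlib

open scoped LinearPMap

/-! Unbounded operators on complex Hilbert spaces are partially defined linear maps
`H →ₗ.[ℂ] H`; `A†` is the Hilbert space adjoint and `A.closure` the closure. -/

namespace QOscillator

universe u

section Operators

variable {H : Type u} [NormedAddCommGroup H] [InnerProductSpace ℂ H]

/-- The product `A B` of two operators, on its maximal domain
`{x ∈ D(B) : B x ∈ D(A)}`. -/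
def prodOp (A B : H →ₗ.[ℂ] H) : H →ₗ.[ℂ] H where
  domain :=
    { carrier := {x | ∃ h : x ∈ B.domain, B ⟨x, h⟩ ∈ A.domain}
      zero_mem' := ⟨B.domain.zero_mem, by
        have h : B (0 : B.domain) ∈ A.domain := by
          rw [LinearPMap.map_zero]; exact A.domain.zero_mem
        exact h⟩
      add_mem' := by
        rintro x y ⟨hx, hx'⟩ ⟨hy, hy'⟩
        refine ⟨B.domain.add_mem hx hy, ?_⟩
        have h : B (⟨x, hx⟩ + ⟨y, hy⟩ : B.domain) ∈ A.domain := by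
          rw [LinearPMap.map_add]; exact A.domain.add_mem hx' hy'
        exact h
      smul_mem' := by
        rintro c x ⟨hx, hx'⟩
        refine ⟨B.domain.smul_mem c hx, ?_⟩
        have h : B (c • ⟨x, hx⟩ : B.domain) ∈ A.domain := by
          rw [LinearPMap.map_smul]; exact A.domain.smul_mem c hx'
        exact h }
  toFun :=
    { toFun := fun x => A ⟨B ⟨x.1, x.2.fst⟩, x.2.snd⟩
      map_add' := by
        intro x y
        rw [← LinearPMap.map_add]
        congr 1
        apply Subtype.ext
        exact LinearPMap.map_add B ⟨x.1, x.2.fst⟩ ⟨y.1, y.2.fst⟩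
      map_smul' := by
        intro c x
        rw [RingHom.id_apply, ← LinearPMap.map_smul]
        congr 1
        apply Subtype.ext
        exact LinearPMap.map_smul B c ⟨x.1, x.2.fst⟩ }

/-- `‖A f‖ ≤ M ‖f‖` on the domain of `A`, for some constant `M`. -/
def IsBounded (A : H →ₗ.[ℂ] H) : Prop :=
  ∃ M : ℝ, ∀ f : A.domain, ‖A f‖ ≤ M * ‖(f : H)‖

/-- The operator norm of a bounded operator (only meaningful together with `IsBounded A`). -/
noncomputable def opNorm (A : H →ₗ.[ℂ] H) : ℝ :=
  sInf {M : ℝ | 0 ≤ M ∧ ∀ f : A.domain, ‖A f‖ ≤ M * ‖(f : H)‖}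

variable [CompleteSpace H]

/-- A densely defined operator `A` is hyponormal if `D(A) ⊆ D(A*)` and `‖A* f‖ ≤ ‖A f‖` for
`f ∈ D(A)`. -/
structure IsHyponormal (A : H →ₗ.[ℂ] H) : Prop where
  dense_domain : Dense (A.domain : Set H)
  domain_le : A.domain ≤ A†.domain
  norm_le : ∀ f : A.domain, ‖A† ⟨f, domain_le f.2⟩‖ ≤ ‖A f‖

/-- A hyponormal operator is formally normal if `‖A f‖ = ‖A* f‖` for `f ∈ D(A)`. -/
structure IsFormallyNormal (A : H →ₗ.[ℂ] H) : Prop extends IsHyponormal A where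
  norm_eq : ∀ f : A.domain, ‖A f‖ = ‖A† ⟨f, domain_le f.2⟩‖

/-- A formally normal operator is normal if `D(A) = D(A*)`. -/
structure IsNormal (A : H →ₗ.[ℂ] H) : Prop extends IsFormallyNormal A where
  domain_eq : A.domain = A†.domain

/-- A densely defined operator `A` in `H` is subnormal if there are a Hilbert space `K`, an
isometric embedding `V` of `H` into `K`, and a normal operator `N` in `K` that extends `A`. -/
def IsSubnormal (A : H →ₗ.[ℂ] H) : Prop :=
  Dense (A.domain : Set H) ∧
    ∃ (K : Type u) (_ : NormedAddCommGroup K) (_ : InnerProductSpace ℂ K) (_ : CompleteSpace K)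
      (V : H →ₗᵢ[ℂ] K) (N : K →ₗ.[ℂ] K),
      IsNormal N ∧
        ∀ f : A.domain, ∃ h : V f ∈ N.domain, N ⟨V f, h⟩ = V (A f)

/-- The relation `S* S - q S S* = I` on `D`: the operator `S` is closable, `D` is a dense
subspace contained in `D(S* S̄) ∩ D(S̄ S*)`, where `S̄` is the closure of `S`, and
`S* S̄ f - q S̄ S* f = f` for `f ∈ D`. As `D ⊆ D(S̄)` is dense, `S` is densely defined. -/
structure SatisfiesRelation (q : ℝ) (D : Submodule ℂ H) (S : H →ₗ.[ℂ] H) : Prop where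
  closable : S.IsClosable
  dense : Dense (D : Set H)
  le_left : D ≤ (prodOp S† S.closure).domain
  le_right : D ≤ (prodOp S.closure S†).domain
  relation : ∀ f : D, prodOp S† S.closure ⟨f, le_left f.2⟩
    - (q : ℂ) • prodOp S.closure S† ⟨f, le_right f.2⟩ = (f : H)

end Operators

end QOscillator

/-! Boundedness gives subnormality through an explicit dilation. Extend `S` to `T` on all of `H`; by
density `T*T - qTT* = 1`. Hence `‖T‖² ≤ 1 + q‖T‖²`, so `C = T*T - TT* = 1 - (1-q)TT*` is positive,
and `T*C = qCT*`. The functional calculus turns this into `T*R = √q RT*` for `R = √C`. The upper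
bidiagonal matrix with diagonal entries `√q^k T` and superdiagonal entries `(1 + q + ... +
q^k)^{1/2} R` is then normal on `ℓ²(ℕ, H)` and extends `T` on the zeroth summand
(`exists_normal_extension`).

A subnormal operator is hyponormal because its adjoint is a compression of `N*`. Finally,
hyponormality passes to the closure, and pairing the relation with `f` gives `(1-q)‖S̄f‖² ≤ ‖f‖²` on
`D`; the closed graph of `S̄` carries this bound over to `D(S)`. -/

namespace QOscillator

/-! ### Intertwining relations and the continuous functional calculus -/

section Intertwining

variable {A : Type*} [CStarAlgebra A]

/-- If `x` intertwines two elements, it intertwines all polynomials in them. -/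
lemma mul_aeval_eq_aeval_mul {a b x : A} (h : x * a = b * x) (p : Polynomial ℝ) :
    x * Polynomial.aeval a p = Polynomial.aeval b p * x := by
  induction p using Polynomial.induction_on' with
  | add p q hp hq => simp only [map_add, mul_add, add_mul, hp, hq]
  | monomial n r =>
    have hn : x * a ^ n = b ^ n * x := SemiconjBy.pow_right (show SemiconjBy x a b from h) n
    simp only [Polynomial.aeval_monomial, ← Algebra.smul_def, mul_smul_comm, smul_mul_assoc, hn]

/-- If `x` intertwines two self-adjoint elements, it intertwines all continuous functions of
them. -/
lemma mul_cfc_eq_cfc_mul {a b x : A} (ha : IsSelfAdjoint a) (hb : IsSelfAdjoint b)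
    (h : x * a = b * x) {f : ℝ → ℝ} (hf : Continuous f) : x * cfc f a = cfc f b * x := by
  -- `[-M, M]` contains both spectra, so a single polynomial approximates `f` on both.
  set M : ℝ := max (‖a‖ * ‖(1 : A)‖) (‖b‖ * ‖(1 : A)‖) with hM
  have near (c : A) (hc : IsSelfAdjoint c) (hcM : ‖c‖ * ‖(1 : A)‖ ≤ M) (p : Polynomial ℝ) (ε : ℝ)
      (hε : 0 < ε) (hp : ∀ t ∈ Set.Icc (-M) M, |p.eval t - f t| < ε) :
      ‖Polynomial.aeval c p - cfc f c‖ ≤ ε := by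
    rw [← cfc_polynomial p c hc,
      ← cfc_sub p.eval f c p.continuous.continuousOn hf.continuousOn]
    refine norm_cfc_le hε.le fun t ht => (hp t ?_).le
    have := (spectrum.norm_le_norm_mul_of_mem ht).trans hcM
    exact abs_le.mp this
  refine sub_eq_zero.mp (norm_le_zero_iff.mp (le_of_forall_pos_le_add fun ε hε => ?_))
  obtain ⟨p, hp⟩ := exists_polynomial_near_of_continuousOn (-M) M f hf.continuousOn
    (ε / (2 * ‖x‖ + 1)) (by positivity)
  have hpa := near a ha (le_max_left _ _) p _ (by positivity) hp
  have hpb := near b hb (le_max_right _ _) p _ (by positivity) hp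
  have key : x * cfc f a - cfc f b * x = (Polynomial.aeval b p - cfc f b) * x
      - x * (Polynomial.aeval a p - cfc f a) := by
    rw [sub_mul, mul_sub, mul_aeval_eq_aeval_mul h]; abel
  rw [key, zero_add]
  calc _ ≤ ‖(Polynomial.aeval b p - cfc f b) * x‖ + ‖x * (Polynomial.aeval a p - cfc f a)‖ :=
        norm_sub_le _ _
    _ ≤ ε / (2 * ‖x‖ + 1) * ‖x‖ + ‖x‖ * (ε / (2 * ‖x‖ + 1)) := by
        refine add_le_add ((norm_mul_le _ _).trans ?_) ((norm_mul_le _ _).trans ?_) <;> gcongr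
    _ = ε * (2 * ‖x‖ / (2 * ‖x‖ + 1)) := by ring
    _ ≤ ε := mul_le_of_le_one_right hε.le ((div_le_one (by positivity)).mpr (by linarith))

end Intertwining

/-! ### Weighted composition operators on square-summable sequences -/

section WeightedComposition

variable {H : Type*} [NormedAddCommGroup H] [InnerProductSpace ℂ H]

/-- The operator `(x_k) ↦ (g_k x_{σ k})` on `ℓ²(ℕ, H)`, for a uniformly bounded family `g` and an
injective map `σ`. -/
noncomputable def weightedComp (g : ℕ → H →L[ℂ] H) (M : ℝ) (hg : ∀ k, ‖g k‖ ≤ M) (σ : ℕ → ℕ)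
    (hσ : Function.Injective σ) :
    lp (fun _ : ℕ => H) 2 →L[ℂ] lp (fun _ : ℕ => H) 2 :=
  have hM : 0 ≤ M := (norm_nonneg _).trans (hg 0)
  have hle (x : lp (fun _ : ℕ => H) 2) (k : ℕ) :
      ‖g k (x (σ k))‖ ^ 2 ≤ M ^ 2 * ‖x (σ k)‖ ^ 2 := by
    rw [← mul_pow]
    gcongr
    exact (g k).le_of_opNorm_le (hg k) _
  have hsum (x : lp (fun _ : ℕ => H) 2) : Summable fun k => ‖x k‖ ^ 2 := by
    simpa using (memℓp_gen_iff (p := 2) (by norm_num)).mp (lp.memℓp x)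
  have hsum' (x : lp (fun _ : ℕ => H) 2) : Summable fun k => M ^ 2 * ‖x (σ k)‖ ^ 2 :=
    ((hsum x).comp_injective hσ).mul_left _
  have hmem (x : lp (fun _ : ℕ => H) 2) : Memℓp (fun k => g k (x (σ k))) 2 := by
    refine memℓp_gen ?_
    simpa using Summable.of_nonneg_of_le (fun _ => sq_nonneg _) (hle x) (hsum' x)
  LinearMap.mkContinuous
    { toFun := fun x => ⟨fun k => g k (x (σ k)), hmem x⟩
      map_add' := fun x y => by ext k; exact map_add (g k) _ _
      map_smul' := fun c x => by ext k; exact map_smul (g k) _ _ } M fun x => by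
    refine lp.norm_le_of_tsum_le (p := 2) (by norm_num) (by positivity) ?_
    have hx : ‖x‖ ^ 2 = ∑' k, ‖x k‖ ^ 2 := by
      simpa using lp.norm_rpow_eq_tsum (p := 2) (by norm_num) x
    have : ∑' k, ‖g k (x (σ k))‖ ^ 2 ≤ (M * ‖x‖) ^ 2 := by
      rw [mul_pow, hx, ← tsum_mul_left]
      refine (Summable.tsum_le_tsum (hle x) ((hsum' x).of_nonneg_of_le (fun _ => sq_nonneg _)
        (hle x)) (hsum' x)).trans ?_
      rw [tsum_mul_left, tsum_mul_left]
      refine mul_le_mul_of_nonneg_left ?_ (sq_nonneg M)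
      exact tsum_comp_le_tsum_of_inj (f := fun k => ‖x k‖ ^ 2) (hsum x) (fun _ => sq_nonneg _) hσ
    simpa using this

variable (g : ℕ → H →L[ℂ] H) (M : ℝ) (hg : ∀ k, ‖g k‖ ≤ M) (σ : ℕ → ℕ)
  (hσ : Function.Injective σ)

lemma weightedComp_apply (x : lp (fun _ : ℕ => H) 2) (k : ℕ) :
    weightedComp g M hg σ hσ x k = g k (x (σ k)) := rfl

lemma weightedComp_single (k : ℕ) (h : H) :
    weightedComp g M hg σ hσ (lp.single 2 (σ k) h) = lp.single 2 k (g k h) := by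
  ext j
  rw [weightedComp_apply]
  by_cases hj : j = k
  · subst hj; simp
  · rw [lp.single_apply_ne _ _ _ hj, lp.single_apply_ne _ _ _ (hσ.ne hj), map_zero]

lemma weightedComp_single_of_notMem {i : ℕ} (hi : ∀ k, σ k ≠ i) (h : H) :
    weightedComp g M hg σ hσ (lp.single 2 i h) = 0 := by
  ext j
  rw [weightedComp_apply, lp.single_apply_ne _ _ _ (hi j), map_zero]; rfl

variable [CompleteSpace H]

open ContinuousLinearMap in
lemma adjoint_weightedComp_apply (y : lp (fun _ : ℕ => H) 2) (k : ℕ) :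
    adjoint (weightedComp g M hg σ hσ) y (σ k) = adjoint (g k) (y k) := by
  refine ext_inner_right ℂ fun h => ?_
  rw [← lp.inner_single_right, adjoint_inner_left, weightedComp_single, lp.inner_single_right,
    adjoint_inner_left]

open ContinuousLinearMap in
lemma adjoint_weightedComp_apply_of_notMem (y : lp (fun _ : ℕ => H) 2) {i : ℕ}
    (hi : ∀ k, σ k ≠ i) : adjoint (weightedComp g M hg σ hσ) y i = 0 := by
  refine ext_inner_right ℂ fun h => ?_
  rw [← lp.inner_single_right, adjoint_inner_left, weightedComp_single_of_notMem _ _ _ _ _ hi,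
    inner_zero_right, inner_zero_left]

end WeightedComposition

/-! ### The normal extension in the bounded case -/

section BoundedCase

variable {H : Type*} [NormedAddCommGroup H] [InnerProductSpace ℂ H] [CompleteSpace H]

open ContinuousLinearMap in
lemma adjoint_ofReal_smul (r : ℝ) (A : H →L[ℂ] H) :
    adjoint ((r : ℂ) • A) = (r : ℂ) • adjoint A := by
  rw [LinearIsometryEquiv.map_smulₛₗ, Complex.conj_ofReal]

open ContinuousLinearMap in
lemma inner_adjoint_mul_self (A : H →L[ℂ] H) (x : H) :
    inner ℂ ((adjoint A * A) x) x = ((‖A x‖ ^ 2 : ℝ) : ℂ) := by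
  change inner ℂ (adjoint A (A x)) x = _
  rw [adjoint_inner_left, inner_self_eq_norm_sq_to_K]
  push_cast
  rfl

open ContinuousLinearMap in
lemma inner_mul_adjoint_self (A : H →L[ℂ] H) (x : H) :
    inner ℂ ((A * adjoint A) x) x = ((‖adjoint A x‖ ^ 2 : ℝ) : ℂ) := by
  simpa using inner_adjoint_mul_self (adjoint A) x

open ContinuousLinearMap in
/-- A bidiagonal operator matrix with diagonal `d_k T` and superdiagonal `s_k R` which is normal on
`ℓ²(ℕ, H)`. -/
theorem exists_normal_bidiagonal (T R : H →L[ℂ] H) (hR : adjoint R = R)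
    (hRR : adjoint T * T = T * adjoint T + R * R) (a : ℝ)
    (hTR : adjoint T * R = (a : ℂ) • (R * adjoint T)) (d s : ℕ → ℝ) (M : ℝ) (hd : ∀ k, |d k| ≤ M)
    (hs : ∀ k, |s k| ≤ M) (hd_succ : ∀ k, d (k + 1) = a * d k) (hs_zero : s 0 ^ 2 = d 0 ^ 2)
    (hs_succ : ∀ k, s (k + 1) ^ 2 = s k ^ 2 + d (k + 1) ^ 2) :
    ∃ N : lp (fun _ : ℕ => H) 2 →L[ℂ] lp (fun _ : ℕ => H) 2, adjoint N * N = N * adjoint N ∧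
      ∀ h : H, N (lp.single 2 0 h) = lp.single 2 0 ((d 0 : ℂ) • T h) := by
  have hM : 0 ≤ M := (abs_nonneg _).trans (hd 0)
  have hgd (k : ℕ) : ‖(d k : ℂ) • T‖ ≤ M * ‖T‖ := by
    rw [norm_smul, Complex.norm_real]; gcongr; exact hd k
  have hgs (k : ℕ) : ‖(s k : ℂ) • R‖ ≤ M * ‖R‖ := by
    rw [norm_smul, Complex.norm_real]; gcongr; exact hs k
  set P := weightedComp _ _ hgd id Function.injective_id with hP
  set Q := weightedComp _ _ hgs Nat.succ Nat.succ_injective with hQ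
  have hN (x : lp (fun _ : ℕ => H) 2) (k : ℕ) :
      (P + Q) x k = (d k : ℂ) • T (x k) + (s k : ℂ) • R (x (k + 1)) := rfl
  have hP' (y : lp (fun _ : ℕ => H) 2) (k : ℕ) :
      adjoint P y k = (d k : ℂ) • adjoint T (y k) := by
    have := adjoint_weightedComp_apply _ _ hgd id Function.injective_id y k
    rw [adjoint_ofReal_smul] at this
    exact this
  -- Index `0` is not a successor, so the superdiagonal part contributes nothing here.
  have hN0 (y : lp (fun _ : ℕ => H) 2) : adjoint (P + Q) y 0 = (d 0 : ℂ) • adjoint T (y 0) := by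
    have := adjoint_weightedComp_apply_of_notMem _ _ hgs Nat.succ Nat.succ_injective y
      (i := 0) (fun k => Nat.succ_ne_zero k)
    rw [map_add, add_apply, lp.coeFn_add, Pi.add_apply, hP', hQ, this, add_zero]
  have hN1 (y : lp (fun _ : ℕ => H) 2) (k : ℕ) : adjoint (P + Q) y (k + 1)
      = (d (k + 1) : ℂ) • adjoint T (y (k + 1)) + (s k : ℂ) • R (y k) := by
    have := adjoint_weightedComp_apply _ _ hgs Nat.succ Nat.succ_injective y k
    rw [map_add, add_apply, lp.coeFn_add, Pi.add_apply, hP', hQ]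
    congr 1
    rw [adjoint_ofReal_smul, hR] at this
    exact this
  have e1 (z : H) : adjoint T (T z) = T (adjoint T z) + R (R z) := congr($hRR z)
  have e2 (z : H) : adjoint T (R z) = (a : ℂ) • R (adjoint T z) := congr($hTR z)
  have e3 (z : H) : R (T z) = (a : ℂ) • T (R z) := by
    have := congr(adjoint $hTR)
    rw [adjoint_ofReal_smul, mul_def, mul_def, adjoint_comp, adjoint_comp, adjoint_adjoint, hR]
      at this
    exact congr($this z)
  refine ⟨P + Q, ?_, fun h => ?_⟩
  -- Compare matrix entries of `N*N` and `NN*`: the diagonal ones agree by `hRR` and the recursion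
  -- for `s²`, the off-diagonal ones by `hTR` and the recursion for `d`.
  · ext x k
    change adjoint (P + Q) ((P + Q) x) k = (P + Q) (adjoint (P + Q) x) k
    have hd_succ' (k : ℕ) : (d (k + 1) : ℂ) = a * d k := by exact_mod_cast hd_succ k
    have hs_zero' : (s 0 : ℂ) ^ 2 = d 0 ^ 2 := by exact_mod_cast hs_zero
    have hs_succ' (k : ℕ) : (s (k + 1) : ℂ) ^ 2 = s k ^ 2 + d (k + 1) ^ 2 := by
      exact_mod_cast hs_succ k
    rcases k with _ | k
    · rw [hN0, hN, hN, hN1, hN0]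
      simp only [map_add, map_smul, e1, e2, smul_add, smul_smul, zero_add, ← pow_two]
      rw [hs_zero', hd_succ']
      module
    · rw [hN1, hN, hN, hN, hN1, hN1]
      simp only [map_add, map_smul, e1, e2, e3, smul_add, smul_smul, ← pow_two]
      rw [hs_succ', hd_succ' (k + 1)]
      have : (d (k + 1) : ℂ) * s k = s k * d k * a := by rw [hd_succ']; ring
      rw [this]
      module
  · ext k
    rw [hN]
    rcases k with _ | k
    · simp
    · simp

open ContinuousLinearMap in
/-- An everywhere defined bounded solution of `T* T - q T T* = I` has a bounded normal extension. -/
theorem exists_normal_extension {q : ℝ} (hq0 : 0 ≤ q) (hq1 : q < 1) (T : H →L[ℂ] H)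
    (hT : adjoint T * T - (q : ℂ) • (T * adjoint T) = 1) :
    ∃ N : lp (fun _ : ℕ => H) 2 →L[ℂ] lp (fun _ : ℕ => H) 2, adjoint N * N = N * adjoint N ∧
      ∀ h : H, N (lp.single 2 0 h) = lp.single 2 0 (T h) := by
  have hT1 : adjoint T * T = 1 + (q : ℂ) • (T * adjoint T) := sub_eq_iff_eq_add.mp hT
  set C : H →L[ℂ] H := adjoint T * T - T * adjoint T with hC
  have hTq (x : H) : ‖T x‖ ^ 2 = ‖x‖ ^ 2 + q * ‖adjoint T x‖ ^ 2 := by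
    have h := congr(inner ℂ ($hT1 x) x)
    rw [inner_adjoint_mul_self, add_apply, smul_apply, inner_add_left, inner_smul_left,
      inner_mul_adjoint_self, Complex.conj_ofReal] at h
    change _ = inner ℂ x x + _ at h
    rw [inner_self_eq_norm_sq_to_K] at h
    exact Complex.ofReal_injective (h.trans (by push_cast; rfl))
  have hnorm (x : H) : ‖adjoint T x‖ ^ 2 ≤ ‖T x‖ ^ 2 := by
    -- Boundedness is essential here: the finite number `‖T‖²` can be absorbed into the left side.
    have h1 : (1 - q) * ‖T‖ ^ 2 ≤ 1 := by
      have : ‖T‖ ≤ √(1 + q * ‖T‖ ^ 2) := T.opNorm_le_bound (Real.sqrt_nonneg _) fun x => by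
        refine abs_le_of_sq_le_sq' ?_ (by positivity) |>.2
        rw [mul_pow, Real.sq_sqrt (by positivity), hTq, add_mul, one_mul, mul_assoc, ← mul_pow]
        gcongr
        simpa using (adjoint T).le_opNorm x
      have := pow_le_pow_left₀ (norm_nonneg _) this 2
      rw [Real.sq_sqrt (by positivity)] at this
      linarith
    have h2 : (1 - q) * ‖adjoint T x‖ ^ 2 ≤ ‖x‖ ^ 2 := by
      have : ‖adjoint T x‖ ^ 2 ≤ ‖T‖ ^ 2 * ‖x‖ ^ 2 := by
        rw [← mul_pow]; gcongr; simpa using (adjoint T).le_opNorm x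
      nlinarith [sq_nonneg ‖x‖, sq_nonneg ‖T‖]
    rw [hTq]; linarith
  have hC0 : 0 ≤ C := by
    rw [nonneg_iff_isPositive, isPositive_iff_complex]
    intro x
    have : inner ℂ (C x) x = ((‖T x‖ ^ 2 - ‖adjoint T x‖ ^ 2 : ℝ) : ℂ) := by
      rw [hC, sub_apply, inner_sub_left, inner_adjoint_mul_self, inner_mul_adjoint_self,
        Complex.ofReal_sub]
    rw [this, RCLike.re_eq_complex_re, Complex.ofReal_re]
    exact ⟨rfl, sub_nonneg.mpr (hnorm x)⟩
  have hCT : adjoint T * C = (q • C) * adjoint T := by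
    have : C = 1 + ((q : ℂ) - 1) • (T * adjoint T) := by rw [hC, hT1]; module
    rw [this, mul_add, mul_smul_comm, ← mul_assoc, hT1]
    simp only [← Complex.coe_smul, smul_add, add_mul, smul_mul_assoc, mul_assoc, mul_one, one_mul]
    module
  have hCs : IsSelfAdjoint C := .of_nonneg hC0
  set R : H →L[ℂ] H := cfc Real.sqrt C with hR
  have hRR : R * R = C := by
    rw [hR, ← cfc_mul _ _ C (by fun_prop) (by fun_prop)]
    conv_rhs => rw [← cfc_id ℝ C]
    exact cfc_congr fun t ht => Real.mul_self_sqrt (spectrum_nonneg_of_nonneg hC0 ht)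
  have hRs : adjoint R = R := IsSelfAdjoint.adjoint_eq (cfc_predicate Real.sqrt C)
  have hTR : adjoint T * R = ((√q : ℝ) : ℂ) • (R * adjoint T) := by
    -- Here `T*` intertwines `C` with `qC`, and `√(qC) = √q √C`.
    have h := mul_cfc_eq_cfc_mul hCs (.of_nonneg (smul_nonneg hq0 hC0)) hCT Real.continuous_sqrt
    rw [← cfc_comp_smul q Real.sqrt C (by fun_prop)] at h
    simp only [smul_eq_mul, Real.sqrt_mul hq0] at h
    rw [cfc_const_mul _ _ C (by fun_prop)] at h
    rw [hR, h, smul_mul_assoc, Complex.coe_smul]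
  have hgeom (k : ℕ) : ∑ i ∈ Finset.range (k + 1), q ^ i ≤ (1 - q)⁻¹ := by
    rw [← tsum_geometric_of_lt_one hq0 hq1]
    exact (summable_geometric_of_lt_one hq0 hq1).sum_le_tsum _ fun i _ => pow_nonneg hq0 i
  have h1q : 1 ≤ (1 - q)⁻¹ := (one_le_inv₀ (by linarith)).mpr (by linarith)
  have hgeom0 (k : ℕ) : 0 ≤ ∑ i ∈ Finset.range (k + 1), q ^ i :=
    Finset.sum_nonneg fun i _ => pow_nonneg hq0 i
  -- The recursions with `d 0 = 1` force `d k = √q ^ k` and `s k ^ 2 = ∑ i ≤ k, d i ^ 2`; `(1 - q)⁻¹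
  -- ≥ 1` bounds the sums and hence their roots.
  obtain ⟨N, hN, hN'⟩ := exists_normal_bidiagonal T R hRs (by rw [hRR, hC]; abel) (√q) hTR
    (fun k => √q ^ k) (fun k => √(∑ i ∈ Finset.range (k + 1), q ^ i)) ((1 - q)⁻¹)
    (fun k => by
      rw [abs_of_nonneg (by positivity)]
      exact (pow_le_one₀ (Real.sqrt_nonneg _) (Real.sqrt_le_one.mpr hq1.le)).trans h1q)
    (fun k => by
      rw [abs_of_nonneg (by positivity)]
      refine (Real.sqrt_le_sqrt (hgeom k)).trans (Real.sqrt_le_iff.mpr ⟨by linarith, ?_⟩)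
      nlinarith)
    (fun k => pow_succ' _ _) (by simp)
    (fun k => by
      simp only [Real.sq_sqrt (hgeom0 _)]
      rw [Finset.sum_range_succ, ← pow_mul, mul_comm (k + 1) 2, pow_mul, Real.sq_sqrt hq0])
  exact ⟨N, hN, by simpa using hN'⟩

end BoundedCase

/-! ### Unbounded operators -/

section Unbounded

open ContinuousLinearMap (adjoint)

variable {H : Type*} [NormedAddCommGroup H] [InnerProductSpace ℂ H] [CompleteSpace H]

/-- A densely defined bounded operator extends to an everywhere defined one. -/
lemma exists_clm_of_dense_of_bound (A : H →ₗ.[ℂ] H) (hA : Dense (A.domain : Set H)) (M : ℝ)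
    (hM : ∀ x : A.domain, ‖A x‖ ≤ M * ‖(x : H)‖) :
    ∃ T : H →L[ℂ] H, (∀ x : A.domain, T x = A x) ∧ ∀ x, ‖T x‖ ≤ M * ‖x‖ := by
  have hd : DenseRange A.domain.subtype := by
    simpa [DenseRange] using hA
  exact ⟨A.toFun.extendOfNorm A.domain.subtype,
    fun x => LinearMap.extendOfNorm_eq hd ⟨M, hM⟩ x,
    LinearMap.norm_extendOfNorm_apply_le hd M hM⟩

omit [CompleteSpace H] in
lemma mem_closure_graph {A : H →ₗ.[ℂ] H} (hA : A.IsClosable) (x : A.closure.domain) :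
    ((x : H), A.closure x) ∈ closure (A.graph : Set (H × H)) := by
  rw [← Submodule.topologicalClosure_coe, hA.graph_closure_eq_closure_graph]
  exact A.closure.mem_graph x

omit [CompleteSpace H] in
/-- A bounded everywhere defined operator extending `A` extends the closure of `A`. -/
lemma closure_apply_eq_of_clm {A : H →ₗ.[ℂ] H} (hA : A.IsClosable) (T : H →L[ℂ] H)
    (hT : ∀ x : A.domain, T x = A x) (x : A.closure.domain) : A.closure x = T x := by
  have hc : IsClosed {p : H × H | p.2 = T p.1} := isClosed_eq (by fun_prop) (by fun_prop)
  refine hc.closure_subset_iff.mpr ?_ (mem_closure_graph hA x)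
  rintro ⟨u, v⟩ huv
  obtain ⟨y, rfl, rfl⟩ := (LinearPMap.mem_graph_iff A).mp huv
  exact (hT y).symm

lemma adjoint_apply_eq_of_clm {A : H →ₗ.[ℂ] H} (hA : Dense (A.domain : Set H)) (T : H →L[ℂ] H)
    (hT : ∀ x : A.domain, T x = A x) (y : A†.domain) : A† y = adjoint T y :=
  LinearPMap.adjoint_apply_eq hA y fun x => by
    rw [ContinuousLinearMap.adjoint_inner_left, hT]

/-- Hyponormality of `A` controls `A*` by the closure of `A`. -/
lemma IsHyponormal.norm_adjoint_le_norm_closure {A : H →ₗ.[ℂ] H} (h : IsHyponormal A)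
    (hA : A.IsClosable) {f : H} (hf : f ∈ A.closure.domain) (hf' : f ∈ A†.domain) :
    ‖A† ⟨f, hf'⟩‖ ≤ ‖A.closure ⟨f, hf⟩‖ := by
  -- For fixed `g` the estimate is a closed condition on the pair `(f, Āf)`, so it passes from the
  -- graph of `A` to its closure.
  have key (g : A.domain) : ‖inner ℂ (A† ⟨f, hf'⟩) (g : H)‖ ≤ ‖A.closure ⟨f, hf⟩‖ * ‖(g : H)‖ := by
    rw [LinearPMap.adjoint_isFormalAdjoint h.dense_domain ⟨f, hf'⟩ g]
    have hc : IsClosed {p : H × H | ‖inner ℂ p.1 (A g)‖ ≤ ‖p.2‖ * ‖(g : H)‖} :=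
      isClosed_le (by fun_prop) (by fun_prop)
    refine hc.closure_subset_iff.mpr ?_ (mem_closure_graph hA ⟨f, hf⟩)
    rintro ⟨u, v⟩ huv
    obtain ⟨y, rfl, rfl⟩ := (LinearPMap.mem_graph_iff A).mp huv
    have := LinearPMap.adjoint_isFormalAdjoint h.dense_domain ⟨y, h.domain_le y.2⟩ g
    change ‖inner ℂ (y : H) (A g)‖ ≤ ‖A y‖ * ‖(g : H)‖
    rw [← this]
    refine (norm_inner_le_norm _ _).trans ?_
    gcongr
    exact h.norm_le y
  have hall (z : H) : ‖inner ℂ (A† ⟨f, hf'⟩) z‖ ≤ ‖A.closure ⟨f, hf⟩‖ * ‖z‖ := by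
    have hc : IsClosed {z : H | ‖inner ℂ (A† ⟨f, hf'⟩) z‖ ≤ ‖A.closure ⟨f, hf⟩‖ * ‖z‖} :=
      isClosed_le (by fun_prop) (by fun_prop)
    exact hc.closure_subset_iff.mpr (fun g hg => key ⟨g, hg⟩) (h.dense_domain z)
  have := hall (A† ⟨f, hf'⟩)
  rw [← inner_self_re_eq_norm, ← norm_sq_eq_re_inner, pow_two] at this
  rcases (norm_nonneg (A† ⟨f, hf'⟩)).eq_or_lt with h0 | h0
  · rw [← h0]; exact norm_nonneg _
  · exact le_of_mul_le_mul_right this h0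

/-- A subnormal operator is hyponormal. -/
theorem IsSubnormal.isHyponormal {A : H →ₗ.[ℂ] H} (h : IsSubnormal A) : IsHyponormal A := by
  obtain ⟨hd, K, _, _, _, V, N, hN, hV⟩ := h
  have hmem (f : A.domain) : V f ∈ N†.domain := hN.domain_le (hV f).fst
  set W := adjoint V.toContinuousLinearMap with hW
  -- The compression `V*N*Vf` serves as `A*f`.
  have hin (f g : A.domain) :
      inner ℂ (W (N† ⟨V f, hmem f⟩)) (g : H) = inner ℂ (f : H) (A g) := by
    obtain ⟨hg, hg'⟩ := hV g
    rw [hW, ContinuousLinearMap.adjoint_inner_left]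
    change inner ℂ (N† ⟨V f, hmem f⟩) (V g) = _
    rw [LinearPMap.adjoint_isFormalAdjoint hN.dense_domain ⟨V f, hmem f⟩ ⟨V g, hg⟩, hg',
      V.inner_map_map]
  have hdom : A.domain ≤ A†.domain := fun f hf =>
    LinearPMap.mem_adjoint_domain_of_exists f ⟨_, hin ⟨f, hf⟩⟩
  refine ⟨hd, hdom, fun f => ?_⟩
  rw [LinearPMap.adjoint_apply_eq hd ⟨f, hdom f.2⟩ (hin f)]
  obtain ⟨hf, hf'⟩ := hV f
  calc ‖W (N† ⟨V f, hmem f⟩)‖ ≤ 1 * ‖N† ⟨V f, hmem f⟩‖ := by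
        refine W.le_of_opNorm_le ?_ _
        rw [hW, LinearIsometryEquiv.norm_map]
        exact V.norm_toContinuousLinearMap_le
    _ = ‖N ⟨V f, hf⟩‖ := by rw [one_mul, hN.norm_eq ⟨V f, hf⟩]
    _ = ‖A f‖ := by rw [hf', V.norm_map]

/-- A bounded everywhere defined normal operator is normal as a partially defined operator. -/
lemma isNormal_toPMap_top (N : H →L[ℂ] H) (hN : adjoint N * N = N * adjoint N) :
    IsNormal ((N : H →ₗ[ℂ] H).toPMap ⊤) := by
  have hd : Dense ((⊤ : Submodule ℂ H) : Set H) := dense_univ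
  have hadj := ContinuousLinearMap.toPMap_adjoint_eq_adjoint_toPMap_of_dense (A := N) hd
  have hdom : ((N : H →ₗ[ℂ] H).toPMap ⊤)†.domain = ⊤ := by rw [hadj]; rfl
  have hle : ((N : H →ₗ[ℂ] H).toPMap ⊤).domain ≤ ((N : H →ₗ[ℂ] H).toPMap ⊤)†.domain := by
    rw [hdom]; exact le_top
  have heq (f : ((N : H →ₗ[ℂ] H).toPMap ⊤).domain) : ‖(N : H →ₗ[ℂ] H).toPMap ⊤ f‖
      = ‖((N : H →ₗ[ℂ] H).toPMap ⊤)† ⟨f, hle f.2⟩‖ := by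
    rw [LinearPMap.adjoint_apply_eq (T := (N : H →ₗ[ℂ] H).toPMap ⊤) hd ⟨f, hle f.2⟩
      (x₀ := adjoint N f) fun x => ContinuousLinearMap.adjoint_inner_left N (x : H) (f : H)]
    change ‖N f‖ = ‖adjoint N f‖
    have h := congr(inner ℂ ($hN (f : H)) (f : H))
    rw [inner_adjoint_mul_self, inner_mul_adjoint_self] at h
    exact (sq_eq_sq₀ (norm_nonneg _) (norm_nonneg _)).mp (by exact_mod_cast h)
  exact ⟨⟨⟨hd, hle, fun f => (heq f).ge⟩, heq⟩, hdom.symm⟩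

universe u

lemma isSubnormal_of_clm {H K : Type u} [NormedAddCommGroup H] [InnerProductSpace ℂ H]
    [CompleteSpace H] [NormedAddCommGroup K] [InnerProductSpace ℂ K] [CompleteSpace K]
    {A : H →ₗ.[ℂ] H} (hA : Dense (A.domain : Set H)) (V : H →ₗᵢ[ℂ] K) (N : K →L[ℂ] K)
    (hN : adjoint N * N = N * adjoint N) (hV : ∀ f : A.domain, N (V f) = V (A f)) :
    IsSubnormal A :=
  ⟨hA, K, inferInstance, inferInstance, inferInstance, V, (N : K →ₗ[ℂ] K).toPMap ⊤,
    isNormal_toPMap_top N hN, fun f => ⟨Submodule.mem_top, hV f⟩⟩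

end Unbounded

/-! ### Solutions of the relation -/

section Relation

open ContinuousLinearMap (adjoint)

variable {H : Type*} [NormedAddCommGroup H] [InnerProductSpace ℂ H] [CompleteSpace H]
  {q : ℝ} {D : Submodule ℂ H} {S : H →ₗ.[ℂ] H}

/-- `D` need not lie in `D(S)`, but it lies in `D(S̄)`, which is contained in the norm closure of
`D(S)`. -/
lemma SatisfiesRelation.dense_domain (hS : SatisfiesRelation q D S) :
    Dense (S.domain : Set H) := by
  refine Dense.of_closure (hS.dense.mono fun f hf => ?_)
  have h := mem_closure_graph hS.closable ⟨f, (hS.le_left hf).fst⟩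
  refine closure_mono ?_ (image_closure_subset_closure_image continuous_fst ⟨_, h, rfl⟩)
  rintro _ ⟨⟨u, v⟩, huv, rfl⟩
  obtain ⟨y, rfl, -⟩ := (LinearPMap.mem_graph_iff S).mp huv
  exact y.2

/-- Pair the relation with `f`; `S*` is formally adjoint to `S̄` as well, since the adjointness
identity is a closed condition on the graph. -/
lemma SatisfiesRelation.norm_sq_eq (hS : SatisfiesRelation q D S) {f : H} (hf : f ∈ D) :
    ‖S.closure ⟨f, (hS.le_left hf).fst⟩‖ ^ 2 - q * ‖S† ⟨f, (hS.le_right hf).fst⟩‖ ^ 2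
      = ‖f‖ ^ 2 := by
  obtain ⟨h1, h2⟩ := hS.le_left hf
  obtain ⟨h3, h4⟩ := hS.le_right hf
  have hcl (y : S†.domain) (x : S.closure.domain) :
      inner ℂ (S† y) (x : H) = inner ℂ (y : H) (S.closure x) := by
    have hc : IsClosed {p : H × H | inner ℂ (S† y) p.1 = inner ℂ (y : H) p.2} :=
      isClosed_eq (by fun_prop) (by fun_prop)
    refine hc.closure_subset_iff.mpr ?_ (mem_closure_graph hS.closable x)
    rintro ⟨u, v⟩ huv
    obtain ⟨z, rfl, rfl⟩ := (LinearPMap.mem_graph_iff S).mp huv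
    exact LinearPMap.adjoint_isFormalAdjoint hS.dense_domain y z
  have e1 : inner ℂ (S† ⟨S.closure ⟨f, h1⟩, h2⟩) f = ((‖S.closure ⟨f, h1⟩‖ ^ 2 : ℝ) : ℂ) := by
    rw [hcl ⟨_, h2⟩ ⟨f, h1⟩, inner_self_eq_norm_sq_to_K]; push_cast; rfl
  have e2 : inner ℂ (S.closure ⟨S† ⟨f, h3⟩, h4⟩) f = ((‖S† ⟨f, h3⟩‖ ^ 2 : ℝ) : ℂ) := by
    rw [← inner_conj_symm, ← hcl ⟨f, h3⟩ ⟨_, h4⟩, inner_self_eq_norm_sq_to_K]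
    simp
  have h := congr(inner ℂ $(hS.relation ⟨f, hf⟩) f)
  change inner ℂ (S† ⟨S.closure ⟨f, h1⟩, h2⟩ - (q : ℂ) • S.closure ⟨S† ⟨f, h3⟩, h4⟩) f
    = inner ℂ f f at h
  rw [inner_sub_left, inner_smul_left, e1, e2, Complex.conj_ofReal,
    inner_self_eq_norm_sq_to_K] at h
  exact Complex.ofReal_injective (by push_cast at h ⊢; exact h)

/-- A bounded solution is subnormal. -/
theorem SatisfiesRelation.isSubnormal (hS : SatisfiesRelation q D S) (hq0 : 0 ≤ q) (hq1 : q < 1)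
    (hb : IsBounded S) : IsSubnormal S := by
  obtain ⟨M, hM⟩ := hb
  obtain ⟨T, hT, -⟩ := exists_clm_of_dense_of_bound S hS.dense_domain M hM
  have hrel : adjoint T * T - (q : ℂ) • (T * adjoint T) = 1 := by
    refine ContinuousLinearMap.ext fun x => ?_
    have hc : IsClosed {x : H | (adjoint T * T - (q : ℂ) • (T * adjoint T)) x = x} :=
      isClosed_eq (by fun_prop) (by fun_prop)
    refine hc.closure_subset_iff.mpr (fun f hf => ?_) (hS.dense x)
    obtain ⟨h1, h2⟩ := hS.le_left hf
    obtain ⟨h3, h4⟩ := hS.le_right hf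
    have h : S† ⟨S.closure ⟨f, h1⟩, h2⟩ - (q : ℂ) • S.closure ⟨S† ⟨f, h3⟩, h4⟩ = f :=
      hS.relation ⟨f, hf⟩
    rw [adjoint_apply_eq_of_clm hS.dense_domain T hT,
      closure_apply_eq_of_clm hS.closable T hT ⟨_, h4⟩,
      Subtype.coe_mk, Subtype.coe_mk, closure_apply_eq_of_clm hS.closable T hT,
      adjoint_apply_eq_of_clm hS.dense_domain T hT] at h
    exact h
  obtain ⟨N, hN, hNT⟩ := exists_normal_extension hq0 hq1 T hrel
  refine isSubnormal_of_clm hS.dense_domain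
    { toLinearMap := lp.lsingle (E := fun _ : ℕ => H) 2 0
      norm_map' := fun x => lp.norm_single (E := fun _ : ℕ => H) (p := 2) (by norm_num) 0 x } N hN
    fun f => ?_
  rw [← hT]
  exact hNT f

/-- A hyponormal solution is bounded by `(1 - q)^{-1/2}`. -/
theorem SatisfiesRelation.norm_le_of_isHyponormal (hS : SatisfiesRelation q D S) (hq0 : 0 ≤ q)
    (hq1 : q < 1) (h : IsHyponormal S) (f : S.domain) :
    ‖S f‖ ≤ (1 - q) ^ (-(1 / 2) : ℝ) * ‖(f : H)‖ := by
  have h1q : 0 < 1 - q := by linarith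
  set M : ℝ := (1 - q) ^ (-(1 / 2) : ℝ) with hM
  have hM0 : 0 < M := Real.rpow_pos_of_pos h1q _
  have hM2 : M ^ 2 * (1 - q) = 1 := by
    rw [hM, ← Real.rpow_natCast, ← Real.rpow_mul h1q.le]
    norm_num
    rw [Real.rpow_neg_one, inv_mul_cancel₀ h1q.ne']
  have hDdom : D ≤ S.closure.domain := fun f hf => (hS.le_left hf).fst
  have hbound (f : D) : ‖S.closure ⟨f, hDdom f.2⟩‖ ≤ M * ‖(f : H)‖ := by
    have h1 := hS.norm_sq_eq f.2
    have h2 := pow_le_pow_left₀ (norm_nonneg _)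
      (h.norm_adjoint_le_norm_closure hS.closable (hS.le_left f.2).fst (hS.le_right f.2).fst) 2
    have h3 : (1 - q) * ‖S.closure ⟨f, hDdom f.2⟩‖ ^ 2 ≤ ‖(f : H)‖ ^ 2 := by
      rw [← h1]; nlinarith
    refine (abs_le_of_sq_le_sq' ?_ (by positivity)).2
    calc ‖S.closure ⟨f, hDdom f.2⟩‖ ^ 2
        = M ^ 2 * ((1 - q) * ‖S.closure ⟨f, hDdom f.2⟩‖ ^ 2) := by
          rw [← mul_assoc, hM2, one_mul]
      _ ≤ M ^ 2 * ‖(f : H)‖ ^ 2 := by gcongr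
      _ = (M * ‖(f : H)‖) ^ 2 := (mul_pow _ _ _).symm
  obtain ⟨T, hT, hTM⟩ := exists_clm_of_dense_of_bound
    ⟨D, S.closure.toFun.comp (Submodule.inclusion hDdom)⟩ hS.dense M hbound
  -- `D` is not assumed to be a core of `S`, so the bound on `D` does not pass to `S` by
  -- restriction. Closedness of `S̄` places the whole graph of `T` inside that of `S̄`, which forces
  -- `T = S` on `D(S)`.
  have hgraph (x : H) : (x, T x) ∈ S.closure.graph := by
    have hc : IsClosed {x : H | (x, T x) ∈ S.closure.graph} :=
      IsClosed.preimage (f := fun x : H => (x, T x)) (by fun_prop) hS.closable.closure_isClosed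
    refine hc.closure_subset_iff.mpr (fun f hf => ?_) (hS.dense x)
    have hTf : T f = S.closure ⟨f, hDdom hf⟩ := hT ⟨f, hf⟩
    change (f, T f) ∈ S.closure.graph
    rw [hTf]
    exact S.closure.mem_graph ⟨f, hDdom hf⟩
  have hSf : T f = S f := by
    obtain ⟨y, hy, hy'⟩ := (LinearPMap.mem_graph_iff _).mp (hgraph f)
    exact hy'.symm.trans (S.le_closure.2 hy.symm).symm
  rw [← hSf]
  exact hTM f

end Relation

end QOscillator

theorem mainTheorem3 {H : Type*} [NormedAddCommGroup H] [InnerProductSpace ℂ H] [CompleteSpace H]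
    (q : ℝ) (hq0 : 0 ≤ q) (hq1 : q < 1) (D : Submodule ℂ H) (S : H →ₗ.[ℂ] H)
    (hS : QOscillator.SatisfiesRelation q D S) :
    List.TFAE
      [QOscillator.IsBounded S ∧ QOscillator.opNorm S ≤ (1 - q) ^ (-(1 / 2) : ℝ),
        QOscillator.IsBounded S,
        QOscillator.IsSubnormal S,
        QOscillator.IsHyponormal S] := by
  tfae_have 1 → 2 := And.left
  tfae_have 2 → 3 := hS.isSubnormal hq0 hq1
  tfae_have 3 → 4 := QOscillator.IsSubnormal.isHyponormal
  tfae_have 4 → 1 := fun h =>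
    ⟨⟨_, hS.norm_le_of_isHyponormal hq0 hq1 h⟩, csInf_le ⟨0, fun _ hM => hM.1⟩
      ⟨Real.rpow_nonneg (by linarith) _, hS.norm_le_of_isHyponormal hq0 hq1 h⟩⟩
  tfae_finish
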